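/- **Model.** A dual graph network of size $n$ is a pair of graphs $G\subseteq G'$ on the same $n$ nodes (reliable links, all links). It is bipartite if every edge of $G'$ joins a sender and a receiver (a receiver being a node that is not a sender) and every receiver has a $G'$-neighbour; its maximum receiver degree is the maximum $G'$-degree of a receiver. A distributed algorithm is a collection of $n$ independent randomized processes (probabilistic automata); an adversary assigns them to the nodes by a bijection $proc$ that the processes do not know. In each synchronous round, every process first receives its input from the environment, if any, and decides whether to transmit a packet and which one; then the adversary, who sees everything that has happened so far including the states of the processes and these decisions, chooses a reach set of edges between $E(G)$ and $E(G')$. A transmitting process hears only its own packet; any other process hears the packet of its unique transmitting neighbour in the reach set if there is exactly one, and silence otherwise; then the processes generate outputs. In a centralized algorithm the processes know $proc$, and each may use the current states and inputs of all processes. The inputs are $bcast(m)$ and the outputs $ack(m)$ and $rcv(m)$. The environment is adaptive, uses each message at most once, and gives a node its next input only after an acknowledgment. A node is *active with $m$* in a round if it has received $bcast(m)$ in this or an earlier round and has not output $ack(m)$ before this round. "With high probability" means with probability at least $1-\frac1n$. An algorithm *solves local broadcast* (is a local broadcast algorithm) if, whatever the adversary and the environment do: (1) in every execution each $bcast(m)$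 is eventually answered by exactly one $ack(m)$, and there are no other acknowledgments; (2) in every execution a node outputs $rcv(m)$ at most once, and only while one of its $G'$-neighbours is active with $m$; (3) if $u$ receives $bcast(m)$ in round $r$ and outputs $ack(m)$ in round $r'$, then with high probability every $G$-neighbour of $u$ outputs $rcv(m)$ in a round of $[r,r']$. The contention $c(u,r,r')$ is the maximum over the rounds $t\in[r,r']$ of the number of $G'$-neighbours of $u$ that are active in round $t$. The algorithm *has progress bound* $f:\mathbb N\to\mathbb R$ if for all rounds $r\le r'$ and all nodes $u$, with high probability: if $r'-r>f(c(u,r,r'))$ and some $G$-neighbour of $u$ is active throughout $[r,r']$, then $u$ outputs $rcv(m)$ in a round $\le r'$ for some $m$ with which some node is active in some round of $[r,r']$. **Theorem.** There are absolute constants $C$ and $c>0$ such that for all integers $k\ge 2$ and $\Delta'$ with $20\log k\le\Delta'\le k^{1/10}$ (natural logarithm) there are an integer $n$ with $k<n\le k^4$ and a bipartite dual graph network of size $n$ with maximum receiver degree $\Delta'$ such that, in this network, 1. some centralized local broadcast algorithm has the constant function $C$ as a progress bound; 2. every progress bound $f$ of every distributed local broadcast algorithm satisfies $f(\Delta')\ge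 c\,\Delta'\log n$. This holds even if $f$ is required to bound progress only in one-shot executions, in which inputs occur only at the beginning of the first round and only at senders. -/

import Mathlib

open MeasureTheory
open scoped ENNReal

namespace DualRadio

/-! ## Networks -/

/-- A dual graph network on `n` nodes: the reliable graph `G` and the graph `G'` of all links. -/
structure Network (n : ℕ) where
  G : SimpleGraph (Fin n)
  G' : SimpleGraph (Fin n)
  le : G ≤ G'

/-- A bipartite dual graph network: every link joins a sender and a receiver (a node that is
not a sender), and every receiver has a sender neighbour. -/
structure BipartiteNetwork (n : ℕ) extends Network n where
  senders : Set (Fin n)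
  bipartite : ∀ u v, G'.Adj u v → (u ∈ senders ↔ v ∉ senders)
  receiver_adj : ∀ u, u ∉ senders → ∃ v, G'.Adj u v

open Classical in
/-- The maximum `G'`-degree of a receiver. -/
noncomputable def BipartiteNetwork.maxReceiverDegree {n : ℕ} (N : BipartiteNetwork n) : ℕ :=
  (Finset.univ.filter fun u => u ∉ N.senders).sup fun u => (N.G'.neighborSet u).ncard

/-! ## Algorithms -/

/-- The messages that the environment can hand over for local broadcast. -/
abbrev Msg : Type := ℕ

/-- The outputs of one process at the end of one round: `m ∈ rcv` is the output `rcv(m)`, and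
`ack = some m` is the output `ack(m)`. -/
structure Output where
  rcv : Finset Msg
  ack : Option Msg

/-- A probabilistic automaton with countably many states. In each round it first sees its input
from the environment (`some m` for `bcast(m)`, `none` for no input) and moves to a new state,
possibly transmitting a packet; then it sees what it has heard on the channel (`none` is silence),
moves to a new state and generates its outputs. Both moves are random: each of them is driven by a
fresh real number drawn uniformly from the unit interval. -/
structure Automaton (Packet : Type) where
  State : Type
  countable_state : Countable State
  start : State
  send : State → Option Msg → unitInterval → State × Option Packet
  receive : State → Option Packet → unitInterval → State × Output
  measurable_send : ∀ s b x, MeasurableSet {c | send s b c = x}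
  measurable_receive : ∀ s p x, MeasurableSet {c | receive s p c = x}

/-- A distributed algorithm: `n` randomized processes, with identifiers in `Fin n`. -/
structure DistributedAlgorithm (n : ℕ) where
  Packet : Type
  countable_packet : Countable Packet
  automaton : Fin n → Automaton Packet

/-- A centralized algorithm: as a distributed algorithm, but the processes are given the bijection
`proc` from nodes to processes, and the behaviour of each process may depend on the current states
and the inputs of all processes. All families are indexed by process identifiers. -/
structure CentralizedAlgorithm (n : ℕ) where
  Packet : Type
  countable_packet : Countable Packet
  State : Fin n → Type
  countable_state : ∀ i, Countable (State i)
  start : (proc : Fin n ≃ Fin n) → ∀ i, State i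
  send : (proc : Fin n ≃ Fin n) → (∀ j, State j) → (Fin n → Option Msg) →
    ∀ i, unitInterval → State i × Option Packet
  receive : (proc : Fin n ≃ Fin n) → (∀ j, State j) →
    ∀ i, Option Packet → unitInterval → State i × Output
  measurable_send : ∀ proc s b i x, MeasurableSet {c | send proc s b i c = x}
  measurable_receive : ∀ proc s i p x, MeasurableSet {c | receive proc s i p c = x}

/-- A distributed algorithm, regarded as a centralized algorithm in which each process ignores
`proc` and the states and inputs of the other processes. -/
def DistributedAlgorithm.toCentralized {n : ℕ} (D : DistributedAlgorithm n) :
    CentralizedAlgorithm n where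
  Packet := D.Packet
  countable_packet := D.countable_packet
  State i := (D.automaton i).State
  countable_state i := (D.automaton i).countable_state
  start _ i := (D.automaton i).start
  send _ s b i := (D.automaton i).send (s i) (b i)
  receive _ s i := (D.automaton i).receive (s i)
  measurable_send _ s b i := (D.automaton i).measurable_send (s i) (b i)
  measurable_receive _ s i := (D.automaton i).measurable_receive (s i)

/-! ## Executions -/

/-- Everything that happens in one round. Inputs and the reach set refer to nodes; states, packets
and outputs are indexed by process identifiers. -/
structure Round {n : ℕ} (A : CentralizedAlgorithm n) where
  input : Fin n → Option Msg
  midState : ∀ i, A.State i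
  packet : Fin n → Option A.Packet
  reach : SimpleGraph (Fin n)
  endState : ∀ i, A.State i
  output : Fin n → Output

/-- The adversary. It fixes the bijection `proc` from nodes to processes, it plays the environment
(`bcast` gives the input of each node at the beginning of a round), and it chooses the reach set
of each round. Its choices may depend on all that has happened so far (a list of rounds, the most
recent one first); the reach set may also depend on the inputs of the current round, on the states
that the processes are in after deciding whether and what to transmit, and on the packets. -/
structure Adversary {n : ℕ} (N : Network n) (A : CentralizedAlgorithm n) where
  proc : Fin n ≃ Fin n
  bcast : List (Round A) → Fin n → Option Msg
  reach : List (Round A) → (Fin n → Option Msg) → (∀ i, A.State i) →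
    (Fin n → Option A.Packet) → SimpleGraph (Fin n)
  le_reach : ∀ h b s p, N.G ≤ reach h b s p
  reach_le : ∀ h b s p, reach h b s p ≤ N.G'

/-- The random choices of an execution: for each process and each round one number that drives
`send` (index `false`) and one that drives `receive` (index `true`). -/
abbrev Coins (n : ℕ) : Type := Fin n × ℕ × Bool → unitInterval

/-- All random choices are independent and uniform. -/
noncomputable def coinMeasure (n : ℕ) : Measure (Coins n) :=
  Measure.infinitePi fun _ : Fin n × ℕ × Bool => (volume : Measure unitInterval)

/-- With high probability: `p` fails with probability at most `1 / n`. -/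
def WHP (n : ℕ) (p : Coins n → Prop) : Prop :=
  coinMeasure n {ω | ¬ p ω} ≤ (n : ℝ≥0∞)⁻¹

open Classical in
/-- What node `u` hears when node `v` transmits `p v` (`none` if it does not transmit) and the
reach set is `R`: its own packet if it transmits; otherwise the packet of its only transmitting
`R`-neighbour if there is exactly one such neighbour, and silence if not. -/
noncomputable def heard {n : ℕ} {Packet : Type} (R : SimpleGraph (Fin n))
    (p : Fin n → Option Packet) (u : Fin n) : Option Packet :=
  if (p u).isSome then p u
  else if h : ∃! v, R.Adj u v ∧ (p v).isSome then p h.choose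
  else none

section Execution

variable {n : ℕ} {N : Network n} {A : CentralizedAlgorithm n}

/-- The states of the processes after the rounds in the list. -/
def Adversary.stateAfter (adv : Adversary N A) : List (Round A) → ∀ i, A.State i
  | [] => A.start adv.proc
  | x :: _ => x.endState

/-- The round that follows the rounds in the list `h`. -/
noncomputable def Adversary.nextRound (adv : Adversary N A) (ω : Coins n)
    (h : List (Round A)) : Round A :=
  let b := adv.bcast h
  let sent := fun i => A.send adv.proc (adv.stateAfter h) (fun j => b (adv.proc.symm j)) i
    (ω (i, h.length, false))
  let s := fun i => (sent i).1
  let p := fun i => (sent i).2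
  let R := adv.reach h b s p
  let received := fun i => A.receive adv.proc s i
    (heard R (fun v => p (adv.proc v)) (adv.proc.symm i)) (ω (i, h.length, true))
  { input := b
    midState := s
    packet := p
    reach := R
    endState := fun i => (received i).1
    output := fun i => (received i).2 }

/-- The first `r` rounds of the execution, the most recent one first. -/
noncomputable def Adversary.history (adv : Adversary N A) (ω : Coins n) : ℕ → List (Round A)
  | 0 => []
  | r + 1 => adv.nextRound ω (adv.history ω r) :: adv.history ω r

/-- Round `r` of the execution; the rounds are numbered `0, 1, 2, …`. -/
noncomputable def Adversary.round (adv : Adversary N A) (ω : Coins n) (r : ℕ) : Round A :=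
  adv.nextRound ω (adv.history ω r)

/-- Node `u` receives the input `bcast(m)` in round `r`. -/
def Adversary.Bcast (adv : Adversary N A) (ω : Coins n) (u : Fin n) (r : ℕ) (m : Msg) : Prop :=
  (adv.round ω r).input u = some m

/-- Node `u` generates the output `ack(m)` in round `r`. -/
def Adversary.Ack (adv : Adversary N A) (ω : Coins n) (u : Fin n) (r : ℕ) (m : Msg) : Prop :=
  ((adv.round ω r).output (adv.proc u)).ack = some m

/-- Node `u` generates the output `rcv(m)` in round `r`. -/
def Adversary.Rcv (adv : Adversary N A) (ω : Coins n) (u : Fin n) (r : ℕ) (m : Msg) : Prop :=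
  m ∈ ((adv.round ω r).output (adv.proc u)).rcv

/-- Node `u` is active with `m` in round `r`: it has received `bcast(m)` in a round `≤ r` and has
not generated `ack(m)` in response before round `r` (inputs come at the beginning of a round,
outputs at its end). -/
def Adversary.ActiveWith (adv : Adversary N A) (ω : Coins n) (u : Fin n) (r : ℕ) (m : Msg) :
    Prop :=
  ∃ r₀ ≤ r, adv.Bcast ω u r₀ m ∧ ∀ r₁, r₀ ≤ r₁ → r₁ < r → ¬ adv.Ack ω u r₁ m

/-- Node `u` is active in round `r`. -/
def Adversary.Active (adv : Adversary N A) (ω : Coins n) (u : Fin n) (r : ℕ) : Prop :=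
  ∃ m, adv.ActiveWith ω u r m

/-- The contention `c(u, r)`: the number of `G'`-neighbours of `u` that are active in round `r`. -/
noncomputable def Adversary.contention (adv : Adversary N A) (ω : Coins n) (u : Fin n) (r : ℕ) :
    ℕ :=
  {v | N.G'.Adj u v ∧ adv.Active ω v r}.ncard

/-- The contention `c(u, r, r')`: the maximum of `c(u, t)` over the rounds `t ∈ [r, r']`. -/
noncomputable def Adversary.maxContention (adv : Adversary N A) (ω : Coins n) (u : Fin n)
    (r r' : ℕ) : ℕ :=
  (Finset.Icc r r').sup fun t => adv.contention ω u t

/-- The environment is well-formed: in every execution every message is handed over at most once,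
and a node that has received an input gets the next one only after it has generated an
acknowledgment. -/
def Adversary.WellFormed (adv : Adversary N A) : Prop :=
  ∀ ω : Coins n,
    (∀ u v r t m, adv.Bcast ω u r m → adv.Bcast ω v t m → u = v ∧ r = t) ∧
    (∀ u r t m m', r < t → adv.Bcast ω u r m → adv.Bcast ω u t m' →
      ∃ q, r ≤ q ∧ q < t ∧ ∃ m'', adv.Ack ω u q m'')

/-- The one-shot setting with sender set `S`: inputs occur only at the beginning of the first
round and only at nodes of `S`. -/
def Adversary.OneShot (adv : Adversary N A) (S : Set (Fin n)) : Prop :=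
  ∀ (ω : Coins n) u r m, adv.Bcast ω u r m → r = 0 ∧ u ∈ S

/-- The progress property with delay function `f`, against one adversary: for all rounds `r ≤ r'`
and every node `u`, with high probability, if `r' - r > f (c(u, r, r'))` and some `G`-neighbour of
`u` is active throughout `[r, r']`, then `u` generates `rcv(m)` in a round `≤ r'` for some message
`m` that was active at some round of `[r, r']`. -/
def Adversary.Progress (adv : Adversary N A) (f : ℕ → ℝ) : Prop :=
  ∀ (r r' : ℕ) (u : Fin n), r ≤ r' → WHP n fun ω =>
    f (adv.maxContention ω u r r') < (r' : ℝ) - r →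
    (∃ v, N.G.Adj u v ∧ ∀ t, r ≤ t → t ≤ r' → adv.Active ω v t) →
    ∃ r'' ≤ r', ∃ m, adv.Rcv ω u r'' m ∧
      ∃ t, r ≤ t ∧ t ≤ r' ∧ ∃ w, adv.ActiveWith ω w t m

end Execution

/-! ## The local broadcast problem -/

/-- The algorithm `A` solves the local broadcast problem in the network `N`. -/
structure CentralizedAlgorithm.SolvesLocalBroadcast {n : ℕ} (A : CentralizedAlgorithm n)
    (N : Network n) : Prop where
  /-- Every `bcast(m)` is answered by exactly one `ack(m)`. -/
  ack_existsUnique : ∀ adv : Adversary N A, adv.WellFormed → ∀ ω u r m,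
    adv.Bcast ω u r m → ∃! r', r ≤ r' ∧ adv.Ack ω u r' m
  /-- There are no other acknowledgments. -/
  ack_response : ∀ adv : Adversary N A, adv.WellFormed → ∀ ω u r' m,
    adv.Ack ω u r' m → ∃ r ≤ r', adv.Bcast ω u r m
  /-- A node outputs `rcv(m)` at most once. -/
  rcv_unique : ∀ adv : Adversary N A, adv.WellFormed → ∀ ω v r t m,
    adv.Rcv ω v r m → adv.Rcv ω v t m → r = t
  /-- A node outputs `rcv(m)` only if some `G'`-neighbour is active with `m`. -/
  rcv_active : ∀ adv : Adversary N A, adv.WellFormed → ∀ ω v r m,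
    adv.Rcv ω v r m → ∃ u, N.G'.Adj v u ∧ adv.ActiveWith ω u r m
  /-- With high probability, every `G`-neighbour outputs `rcv(m)` between `bcast(m)` and
  `ack(m)`. -/
  delivery : ∀ adv : Adversary N A, adv.WellFormed → ∀ u r m, WHP n fun ω =>
    adv.Bcast ω u r m → ∀ r', r ≤ r' → adv.Ack ω u r' m →
      ∀ v, N.G.Adj u v → ∃ t, r ≤ t ∧ t ≤ r' ∧ adv.Rcv ω v t m

/-- `f` is a progress bound (a delay function `f_prog`) of `A` in the network `N`. -/
def CentralizedAlgorithm.HasProgressBound {n : ℕ} (A : CentralizedAlgorithm n) (N : Network n)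
    (f : ℕ → ℝ) : Prop :=
  ∀ adv : Adversary N A, adv.WellFormed → adv.Progress f

/-- `f` is a progress bound of `A` in the network `N`, as far as the one-shot executions with
sender set `S` are concerned. Every progress bound has this property. -/
def CentralizedAlgorithm.HasOneShotProgressBound {n : ℕ} (A : CentralizedAlgorithm n)
    (N : Network n) (S : Set (Fin n)) (f : ℕ → ℝ) : Prop :=
  ∀ adv : Adversary N A, adv.WellFormed → adv.OneShot S → adv.Progress f

end DualRadio

/-! The network is a star: receiver `0` has a reliable link to sender `1` and unreliable links to
senders `2, …, Δ'`. The senders up to `k` have no links; they only give the adversary `k` processes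
from which to choose the neighbours of `0`. A centralized algorithm knows which processes sit at `0`
and `1` and lets only these transmit, in alternate rounds, so nothing ever collides.

Against a distributed algorithm, the adversary `spoiler` hands a message to every sender and
switches on all links exactly when `0` or `1` transmits. Suppose that whenever the process at node
`1` transmits, so does one at some node `2, …, Δ'` (`Covered`). Then node `0` hears nothing but its
own packets, and by `spoiler_run` the execution at the linked nodes agrees with a reference run that
does not depend on `proc`. Hence fixed coins determine, in advance of `proc`, the set `A t` of
processes transmitting in each round. Node `0` cannot deliver a message that it has no information
about (`refReceived_rcv_eq_empty`).

It remains to find assignments that are covered often enough. Draw the process `v` for node `1`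
uniformly, and let `W`, the processes for the other neighbours, contain each process with
probability `q = Δ' / (4k)`. By Harris' inequality and convexity (`card_mul_le_sum_cover`), `W` hits
every `A t` containing `v`, `t < T`, with probability at least `exp (-T / (q k))`, and the side
conditions on `v` and `W` cost little. For `T` about `Δ' log n / 16` this is still at least
`k^(-1/2) / 2`. But delivery and progress let each fixed assignment fail with probability at most `2
/ n` (`coinMeasure_no_rcv_le`), so averaging over `(v, W)` in `failure_probability_le` gives a
contradiction. -/

namespace DualRadio

/-! ## Random subsets -/

section RandomSubset

variable {ι : Type*} [Fintype ι] [DecidableEq ι]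

/-- The probability of the set `W` when every element is included independently with
probability `q`. -/
noncomputable def bernoulliWeight (q : ℝ) (W : Finset ι) : ℝ :=
  ∏ x, if x ∈ W then q else 1 - q

theorem bernoulliWeight_nonneg {q : ℝ} (h0 : 0 ≤ q) (h1 : q ≤ 1) (W : Finset ι) :
    0 ≤ bernoulliWeight q W :=
  Finset.prod_nonneg fun x _ => by split_ifs <;> linarith

/-- This is the generating function of the random set, by expanding the product. The choices `g =
1`, `g` the indicator of the complement of `A`, and `g = 2` give the total mass, the probability of
missing `A`, and the tail of the cardinality. -/
theorem sum_bernoulliWeight_mul_prod (q : ℝ) (g : ι → ℝ) :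
    ∑ W : Finset ι, bernoulliWeight q W * ∏ x ∈ W, g x = ∏ x, (q * g x + (1 - q)) := by
  rw [Finset.prod_add, Finset.powerset_univ]
  refine Finset.sum_congr rfl fun W _ => ?_
  rw [bernoulliWeight, Finset.prod_ite, Finset.prod_mul_distrib]
  have h1 : Finset.univ.filter (fun x => x ∈ W) = W := by ext; simp
  have h2 : Finset.univ.filter (fun x => x ∉ W) = Finset.univ \ W := by ext; simp
  rw [h1, h2]
  ring

theorem sum_bernoulliWeight (q : ℝ) : ∑ W : Finset ι, bernoulliWeight q W = 1 := by
  simpa using sum_bernoulliWeight_mul_prod q (fun _ : ι => (1 : ℝ))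

/-- Log-supermodularity, the hypothesis of `fkg`. For a product measure it is an equality, factor by
factor. -/
theorem bernoulliWeight_mul_le (q : ℝ) (V W : Finset ι) :
    bernoulliWeight q V * bernoulliWeight q W ≤
      bernoulliWeight q (V ⊓ W) * bernoulliWeight q (V ⊔ W) := by
  apply le_of_eq
  simp only [bernoulliWeight, ← Finset.prod_mul_distrib]
  refine Finset.prod_congr rfl fun x _ => ?_
  by_cases hV : x ∈ V <;> by_cases hW : x ∈ W <;> simp [hV, hW, mul_comm]

theorem sum_bernoulliWeight_disjoint (q : ℝ) (A : Finset ι) :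
    ∑ W : Finset ι, bernoulliWeight q W * (if Disjoint W A then 1 else 0) = (1 - q) ^ A.card := by
  have h := sum_bernoulliWeight_mul_prod q (fun x : ι => if x ∈ A then (0 : ℝ) else 1)
  have h1 : ∀ W : Finset ι, (∏ x ∈ W, if x ∈ A then (0 : ℝ) else 1) =
      if Disjoint W A then 1 else 0 := by
    intro W
    by_cases hd : Disjoint W A
    · rw [if_pos hd]
      exact Finset.prod_eq_one fun x hx => if_neg (Finset.disjoint_left.1 hd hx)
    · rw [if_neg hd]
      obtain ⟨x, hx, hA⟩ := Finset.not_disjoint_iff.1 hd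
      exact Finset.prod_eq_zero hx (if_pos hA)
  simp only [h1] at h
  rw [h]
  have h2 : ∀ x : ι, q * (if x ∈ A then (0 : ℝ) else 1) + (1 - q) = if x ∈ A then 1 - q else 1 := by
    intro x; split_ifs <;> ring
  simp only [h2]
  rw [Finset.prod_ite_mem, Finset.univ_inter, Finset.prod_const]

theorem sum_bernoulliWeight_not_disjoint (q : ℝ) (A : Finset ι) :
    ∑ W : Finset ι, bernoulliWeight q W * (if ¬ Disjoint W A then 1 else 0) =
      1 - (1 - q) ^ A.card := by
  rw [← sum_bernoulliWeight_disjoint q A, ← sum_bernoulliWeight (ι := ι) q,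
    ← Finset.sum_sub_distrib]
  refine Finset.sum_congr rfl fun W _ => ?_
  by_cases h : Disjoint W A <;> simp [h, sum_bernoulliWeight]

theorem sum_bernoulliWeight_mem (q : ℝ) (v : ι) :
    ∑ W : Finset ι, bernoulliWeight q W * (if v ∈ W then 1 else 0) = q := by
  have h := sum_bernoulliWeight_not_disjoint q {v}
  simpa using h

/-- Markov's inequality for `2 ^ |W|`, whose expectation is `(1 + q) ^ |ι|`. -/
theorem sum_bernoulliWeight_card_ge {q : ℝ} (h0 : 0 ≤ q) (h1 : q ≤ 1) (d : ℕ) :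
    ∑ W : Finset ι, bernoulliWeight q W * (if d ≤ W.card then 1 else 0) ≤
      Real.exp (q * Fintype.card ι) / 2 ^ d := by
  have h := sum_bernoulliWeight_mul_prod q (fun _ : ι => (2 : ℝ))
  simp only [Finset.prod_const, Finset.card_univ] at h
  have h2 : (q * 2 + (1 - q)) ^ Fintype.card ι ≤ Real.exp (q * Fintype.card ι) := by
    rw [mul_comm q (Fintype.card ι : ℝ), Real.exp_nat_mul]
    exact pow_le_pow_left₀ (by linarith) (by linarith [Real.add_one_le_exp q]) _
  rw [le_div_iff₀ (by positivity)]
  refine le_trans ?_ (h.le.trans h2)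
  rw [Finset.sum_mul]
  refine Finset.sum_le_sum fun W _ => ?_
  rw [mul_assoc]
  refine mul_le_mul_of_nonneg_left ?_ (bernoulliWeight_nonneg h0 h1 W)
  split_ifs with hd
  · rw [one_mul]; exact pow_le_pow_right₀ (by norm_num) hd
  · rw [zero_mul]; positivity

/-- Harris' inequality for hitting several sets. -/
theorem prod_le_sum_bernoulliWeight_hit {τ : Type*} {q : ℝ} (h0 : 0 ≤ q) (h1 : q ≤ 1)
    (A : τ → Finset ι) (L : Finset τ) :
    ∏ t ∈ L, (1 - (1 - q) ^ (A t).card) ≤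
      ∑ W : Finset ι, bernoulliWeight q W *
        ∏ t ∈ L, (if ¬ Disjoint W (A t) then (1 : ℝ) else 0) := by
  classical
  have hmono : ∀ t, Monotone fun W : Finset ι => if ¬ Disjoint W (A t) then (1 : ℝ) else 0 := by
    intro t V W hVW
    by_cases h : Disjoint W (A t)
    · simp [h, Disjoint.mono_left hVW h]
    · simp only [h, not_false_eq_true, if_true]; split_ifs <;> norm_num
  have hnn : ∀ t (W : Finset ι), 0 ≤ if ¬ Disjoint W (A t) then (1 : ℝ) else 0 := by
    intro t W; split_ifs <;> norm_num
  induction L using Finset.induction_on with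
  | empty => simp [sum_bernoulliWeight]
  | insert t L ht ih =>
    -- Hitting `A t` and hitting all the sets in `L` are both increasing events, hence positively
    -- correlated.
    have hf := fkg (α := Finset ι) (β := ℝ) (μ := bernoulliWeight q)
      (f := fun W => if ¬ Disjoint W (A t) then (1 : ℝ) else 0)
      (g := fun W => ∏ t ∈ L, (if ¬ Disjoint W (A t) then (1 : ℝ) else 0))
      (bernoulliWeight_nonneg h0 h1) (hnn t) (fun W => Finset.prod_nonneg fun s _ => hnn s W)
      (hmono t) (fun V W hVW => Finset.prod_le_prod (fun s _ => hnn s V) fun s _ => hmono s hVW)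
      (bernoulliWeight_mul_le q)
    rw [sum_bernoulliWeight_not_disjoint, sum_bernoulliWeight, one_mul] at hf
    simp only [Finset.prod_insert ht]
    refine le_trans (mul_le_mul_of_nonneg_left ih ?_) hf
    have := pow_le_one₀ (n := (A t).card) (by linarith : 0 ≤ 1 - q) (by linarith)
    linarith

/-- Bernoulli's inequality and `(1 - q)(1 + q) ≤ 1` give `(1 - q) ^ m ≤ 1 / (1 + q m)`, so the right
side is at least `1 / (1 + 1 / (q m))`; then `1 + z ≤ exp z`. The exponent is inversely proportional
to `m` so that it cancels when summed over a set of size `m`. -/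
theorem exp_neg_inv_le_one_sub_pow {q : ℝ} (h0 : 0 < q) (h1 : q ≤ 1) {m : ℕ} (hm : m ≠ 0) :
    Real.exp (-(q * m)⁻¹) ≤ 1 - (1 - q) ^ m := by
  have hm' : (0 : ℝ) < m := by positivity
  have hqm : 0 < q * m := by positivity
  have h2 : (1 - q) ^ m * (1 + q * m) ≤ 1 := by
    calc (1 - q) ^ m * (1 + q * m) ≤ (1 - q) ^ m * (1 + q) ^ m := by
          refine mul_le_mul_of_nonneg_left ?_ (pow_nonneg (by linarith) _)
          have := one_add_mul_le_pow (a := q) (by linarith) m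
          linarith
      _ = (1 - q ^ 2) ^ m := by rw [← mul_pow]; ring
      _ ≤ 1 := pow_le_one₀ (by nlinarith) (by nlinarith)
  have h3 : Real.exp (-(q * m)⁻¹) * (1 + (q * m)⁻¹) ≤ 1 := by
    calc _ ≤ Real.exp (-(q * m)⁻¹) * Real.exp ((q * m)⁻¹) := by
          refine mul_le_mul_of_nonneg_left ?_ (Real.exp_pos _).le
          linarith [Real.add_one_le_exp ((q * m)⁻¹)]
      _ = 1 := by rw [← Real.exp_add]; simp
  have h4 : Real.exp (-(q * m)⁻¹) * (1 + q * m) ≤ q * m := by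
    have := mul_le_mul_of_nonneg_right h3 hqm.le
    have h5 : (q * m)⁻¹ * (q * m) = 1 := inv_mul_cancel₀ hqm.ne'
    calc _ = Real.exp (-(q * m)⁻¹) * ((q * m) + (q * m)⁻¹ * (q * m)) := by rw [h5]; ring
      _ = Real.exp (-(q * m)⁻¹) * (1 + (q * m)⁻¹) * (q * m) := by ring
      _ ≤ _ := by linarith
  have h6 : 0 < 1 + q * m := by linarith
  refine le_of_mul_le_mul_right ?_ h6
  linarith

open Classical in
/-- If a set `W` and an element `v` are chosen at random, then `W` meets every one of
`T` given sets that contains `v`, with probability at least `exp (-T / (q * N))`; the other terms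
account for the requirements that `W` be small and not contain `v`. -/
theorem card_mul_le_sum_cover [Nonempty ι] {q : ℝ} (h0 : 0 < q) (h1 : q ≤ 1) (d T : ℕ)
    (A : ℕ → Finset ι) :
    Fintype.card ι * (Real.exp (-(T / (q * Fintype.card ι))) - q -
        Real.exp (q * Fintype.card ι) / 2 ^ d) ≤
      ∑ v : ι, ∑ W : Finset ι, bernoulliWeight q W *
        (if v ∉ W ∧ W.card < d ∧ ∀ t < T, v ∈ A t → ∃ x ∈ W, x ∈ A t then 1 else 0) := by
  set N : ℝ := (Fintype.card ι : ℝ) with hN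
  have hNpos : 0 < N := by rw [hN]; exact_mod_cast Fintype.card_pos
  -- The exponent in the bound for hitting all the sets that contain `v`.
  let Y : ι → ℝ := fun v => ∑ t ∈ Finset.range T with v ∈ A t, (q * (A t).card)⁻¹
  have hstep : ∀ v : ι, Real.exp (-Y v) - q - Real.exp (q * N) / 2 ^ d ≤
      ∑ W : Finset ι, bernoulliWeight q W *
        (if v ∉ W ∧ W.card < d ∧ ∀ t < T, v ∈ A t → ∃ x ∈ W, x ∈ A t then 1 else 0) := by
    intro v
    have e1 : Real.exp (-Y v) ≤ ∑ W : Finset ι, bernoulliWeight q W *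
        ∏ t ∈ Finset.range T with v ∈ A t, (if ¬ Disjoint W (A t) then (1 : ℝ) else 0) := by
      refine le_trans ?_ (prod_le_sum_bernoulliWeight_hit h0.le h1 A _)
      rw [← Finset.sum_neg_distrib, Real.exp_sum]
      refine Finset.prod_le_prod (fun _ _ => (Real.exp_pos _).le) fun t ht => ?_
      refine exp_neg_inv_le_one_sub_pow h0 h1 ?_
      exact (Finset.card_pos.2 ⟨v, (Finset.mem_filter.1 ht).2⟩).ne'
    have e2 := sum_bernoulliWeight_mem q v
    have e3 := sum_bernoulliWeight_card_ge (ι := ι) h0.le h1 d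
    rw [← hN] at e3
    calc _ ≤ (∑ W : Finset ι, bernoulliWeight q W *
          ∏ t ∈ Finset.range T with v ∈ A t, (if ¬ Disjoint W (A t) then (1 : ℝ) else 0)) -
          (∑ W : Finset ι, bernoulliWeight q W * (if v ∈ W then 1 else 0)) -
          ∑ W : Finset ι, bernoulliWeight q W * (if d ≤ W.card then 1 else 0) := by linarith
      _ ≤ _ := by
        rw [← Finset.sum_sub_distrib, ← Finset.sum_sub_distrib]
        -- A union bound, pointwise in `W`: all hits, minus `v ∈ W`, minus `W` too large.
        refine Finset.sum_le_sum fun W _ => ?_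
        rw [← mul_sub, ← mul_sub]
        refine mul_le_mul_of_nonneg_left ?_ (bernoulliWeight_nonneg h0.le h1 W)
        have hp1 : ∏ t ∈ Finset.range T with v ∈ A t,
            (if ¬ Disjoint W (A t) then (1 : ℝ) else 0) ≤ 1 :=
          Finset.prod_le_one (fun _ _ => by split_ifs <;> norm_num)
            fun _ _ => by split_ifs <;> norm_num
        by_cases c1 : v ∈ W
        · simp only [c1, if_true, not_true, false_and, if_false]
          split_ifs <;> linarith
        by_cases c2 : d ≤ W.card
        · simp only [c2, c1, if_true, if_false, not_lt.2 c2, false_and, and_false]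
          linarith
        by_cases c3 : ∀ t < T, v ∈ A t → ∃ x ∈ W, x ∈ A t
        · rw [if_neg c1, if_neg c2, if_pos ⟨c1, not_le.1 c2, c3⟩]
          linarith
        · push Not at c3
          obtain ⟨t, ht, hv, hd⟩ := c3
          rw [Finset.prod_eq_zero (i := t) (by simp [ht, hv])
            (if_neg (by simpa using Finset.disjoint_left.2 hd))]
          split_ifs <;> norm_num
  -- Each round contributes at most `1 / q` in total, however many processes transmit: `|A t|` terms
  -- of size `1 / (q |A t|)`.
  have hY : ∑ v, Y v ≤ T / q := by
    simp only [Y, Finset.sum_filter]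
    rw [Finset.sum_comm]
    have : ∀ t ∈ Finset.range T, (∑ v : ι, if v ∈ A t then (q * (A t).card)⁻¹ else 0) ≤ q⁻¹ := by
      intro t _
      have hA : Finset.univ.filter (fun v => v ∈ A t) = A t := by ext; simp
      rw [← Finset.sum_filter, hA, Finset.sum_const, nsmul_eq_mul]
      rcases eq_or_ne (A t).card 0 with h | h
      · rw [h]; simp [h0.le]
      · have : ((A t).card : ℝ) ≠ 0 := by exact_mod_cast h
        apply le_of_eq; field_simp
    refine (Finset.sum_le_sum this).trans ?_
    simp [div_eq_mul_inv]
  set y : ℝ := T / (q * N) with hy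
  have hyN : N * y = T / q := by rw [hy]; field_simp
  have hJ : N * Real.exp (-y) ≤ ∑ v, Real.exp (-Y v) := by
    -- Jensen's inequality by means of the tangent line of `exp (-·)` at `y`, the upper bound for
    -- the mean of `Y`.
    have : ∀ v, Real.exp (-y) * (1 + y - Y v) ≤ Real.exp (-Y v) := by
      intro v
      have e : -Y v = -y + (y - Y v) := by ring
      rw [e, Real.exp_add]
      refine mul_le_mul_of_nonneg_left ?_ (Real.exp_pos _).le
      linarith [Real.add_one_le_exp (y - Y v)]
    refine le_trans ?_ (Finset.sum_le_sum fun v _ => this v)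
    rw [← Finset.mul_sum, Finset.sum_sub_distrib, Finset.sum_const, Finset.card_univ, nsmul_eq_mul,
      ← hN, mul_comm]
    refine mul_le_mul_of_nonneg_left ?_ (Real.exp_pos _).le
    nlinarith
  refine le_trans ?_ (Finset.sum_le_sum fun v _ => hstep v)
  rw [Finset.sum_sub_distrib, Finset.sum_sub_distrib]
  simp only [Finset.sum_const, Finset.card_univ, nsmul_eq_mul, ← hN]
  linarith

end RandomSubset

open Classical in
/-- An averaging argument that needs no measurability. -/
theorem le_of_forall_le_sum_indicator {Ω I : Type*} [MeasurableSpace Ω] (μ : Measure Ω)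
    [IsProbabilityMeasure μ] (s : Finset I) (w : I → ℝ≥0∞) (F : I → Set Ω) (b δ : ℝ≥0∞)
    (hF : ∀ i ∈ s, μ (F i) ≤ δ)
    (hb : ∀ x, b ≤ ∑ i ∈ s, w i * (if x ∈ F i then 1 else 0)) :
    b ≤ (∑ i ∈ s, w i) * δ := by
  -- Measurable hulls keep the measures and only enlarge the sum.
  have h1 : ∀ x, b ≤ ∑ i ∈ s, w i * (toMeasurable μ (F i)).indicator (fun _ => 1) x := by
    intro x
    refine (hb x).trans (Finset.sum_le_sum fun i _ => ?_)
    gcongr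
    by_cases hx : x ∈ F i
    · simp [hx, subset_toMeasurable μ (F i) hx]
    · simp [hx]
  calc b = ∫⁻ _, b ∂μ := by simp
    _ ≤ ∫⁻ x, ∑ i ∈ s, w i * (toMeasurable μ (F i)).indicator (fun _ => 1) x ∂μ :=
        lintegral_mono h1
    _ = ∑ i ∈ s, w i * μ (F i) := by
        rw [lintegral_finsetSum]
        · refine Finset.sum_congr rfl fun i _ => ?_
          rw [lintegral_const_mul _ (measurable_const.indicator (measurableSet_toMeasurable _ _)),
            lintegral_indicator (measurableSet_toMeasurable _ _)]
          simp
        · exact fun i _ => (measurable_const.indicator (measurableSet_toMeasurable _ _)).const_mul _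
    _ ≤ _ := by
        rw [Finset.sum_mul]
        exact Finset.sum_le_sum fun i hi => by gcongr; exact hF i hi

theorem WHP.of_forall {n : ℕ} {p : Coins n → Prop} (h : ∀ ω, p ω) : WHP n p := by
  have : {ω | ¬ p ω} = ∅ := by ext; simp [h]
  rw [WHP, this, measure_empty]
  exact zero_le

theorem Adversary.length_history {n : ℕ} {N : Network n} {A : CentralizedAlgorithm n}
    (adv : Adversary N A) (ω : Coins n) (r : ℕ) : (adv.history ω r).length = r := by
  induction r with
  | zero => rfl
  | succ r ih => simp [Adversary.history, ih]

/-! ## The network -/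

/-- The network with the single receiver `0`, whose only reliable neighbour is the sender `1` and
whose neighbours are the senders `1, …, D`. -/
def starNetwork (k D : ℕ) (hk : 1 ≤ k) (hD : 1 ≤ D) : BipartiteNetwork (k + 1) where
  G := SimpleGraph.fromRel fun u v => u.val = 0 ∧ v.val = 1
  G' := SimpleGraph.fromRel fun u v => u.val = 0 ∧ 1 ≤ v.val ∧ v.val ≤ D
  le u v h := by
    simp only [SimpleGraph.fromRel_adj] at h ⊢
    omega
  senders := {u | u ≠ 0}
  bipartite u v h := by
    simp only [SimpleGraph.fromRel_adj, ne_eq, Fin.ext_iff] at h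
    simp only [Set.mem_ofPred_eq, ne_eq, Fin.ext_iff, Fin.val_zero]
    omega
  receiver_adj u hu := by
    have hu : u.val = 0 := congrArg Fin.val (not_not.1 hu)
    refine ⟨⟨1, by omega⟩, ?_⟩
    simp only [SimpleGraph.fromRel_adj, ne_eq, Fin.ext_iff]
    omega

section starNetwork

variable {k D : ℕ} {hk : 1 ≤ k} {hD : 1 ≤ D}

theorem starNetwork_G_adj {u v : Fin (k + 1)} : (starNetwork k D hk hD).G.Adj u v ↔
    (u.val = 0 ∧ v.val = 1) ∨ (v.val = 0 ∧ u.val = 1) := by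
  simp only [starNetwork, SimpleGraph.fromRel_adj, ne_eq, Fin.ext_iff]
  omega

theorem starNetwork_G'_adj {u v : Fin (k + 1)} : (starNetwork k D hk hD).G'.Adj u v ↔
    (u.val = 0 ∧ 1 ≤ v.val ∧ v.val ≤ D) ∨ (v.val = 0 ∧ 1 ≤ u.val ∧ u.val ≤ D) := by
  simp only [starNetwork, SimpleGraph.fromRel_adj, ne_eq, Fin.ext_iff]
  omega

theorem ncard_neighborSet_zero (hDk : D ≤ k) :
    ((starNetwork k D hk hD).G'.neighborSet 0).ncard = D := by
  have h : (starNetwork k D hk hD).G'.neighborSet 0 =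
      (fun i : Fin D => (⟨i.val + 1, by omega⟩ : Fin (k + 1))) '' Set.univ := by
    ext v
    simp only [SimpleGraph.mem_neighborSet, starNetwork_G'_adj, Set.image_univ, Set.mem_range,
      Fin.ext_iff, Fin.val_zero, true_and]
    constructor
    · intro h
      exact ⟨⟨v.val - 1, by omega⟩, Nat.sub_add_cancel (by omega)⟩
    · rintro ⟨i, hi⟩
      have hi : i.val + 1 = v.val := hi
      omega
  rw [h, Set.ncard_image_of_injective, Set.ncard_univ, Nat.card_fin]
  intro i j hij
  simpa [Fin.ext_iff] using hij

open Classical in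
theorem maxReceiverDegree_starNetwork (hDk : D ≤ k) :
    (starNetwork k D hk hD).maxReceiverDegree = D := by
  have h : (Finset.univ.filter fun u : Fin (k + 1) => u ∉ (starNetwork k D hk hD).senders) =
      {0} := by
    ext u
    simp [starNetwork]
  rw [BipartiteNetwork.maxReceiverDegree, h, Finset.sup_singleton, ncard_neighborSet_zero hDk]

end starNetwork

/-! ## The centralized algorithm -/

/-- Whether a node has the even rounds (`true`) or the odd rounds (`false`) for transmitting. -/
def slot {k : ℕ} (u : Fin (k + 1)) : Bool := u.val != 0

/-- Time division: node `1` transmits its pending message in the even rounds, node `0` in the odd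
ones, and the other nodes, which have no reliable neighbours, never transmit. The state of a
process consists of the parity of the round (`true` for even) and its pending message, which is
acknowledged at the end of the first round of its own parity. Whatever a node hears in a round of
the other parity is delivered. -/
def timeDivision (k : ℕ) : CentralizedAlgorithm (k + 1) where
  Packet := Msg
  countable_packet := inferInstance
  State _ := Bool × Option Msg
  countable_state _ := inferInstance
  start _ _ := (true, none)
  send proc s b i _ := (((s i).1, (b i).or (s i).2),
    if (s i).1 = slot (proc.symm i) ∧ (proc.symm i).val ≤ 1 then (b i).or (s i).2 else none)
  receive proc s i p _ :=
    if (s i).1 = slot (proc.symm i) then ((!(s i).1, none), ⟨∅, (s i).2⟩)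
    else ((!(s i).1, (s i).2), ⟨p.toFinset, none⟩)
  measurable_send _ _ _ _ _ := MeasurableSet.const _
  measurable_receive _ _ _ _ _ := MeasurableSet.const _

namespace timeDivision

variable {k : ℕ} {N : Network (k + 1)} (adv : Adversary N (timeDivision k)) (ω : Coins (k + 1))

/-- The message that node `u` is handling in round `r`. -/
noncomputable def current (u : Fin (k + 1)) (r : ℕ) : Option Msg :=
  ((adv.round ω r).midState (adv.proc u)).2

/-- The parity of round `r`. -/
def parity (r : ℕ) : Bool := r % 2 == 0

theorem parity_succ (r : ℕ) : parity (r + 1) = !parity r := by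
  rcases Nat.mod_two_eq_zero_or_one r with h | h <;> simp [parity, Nat.add_mod, h]

theorem stateAfter_fst (r : ℕ) (i : Fin (k + 1)) :
    (adv.stateAfter (adv.history ω r) i).1 = parity r := by
  induction r with
  | zero => rfl
  | succ r ih =>
    rw [parity_succ, ← ih]
    simp only [Adversary.history, Adversary.stateAfter, Adversary.nextRound, timeDivision]
    split_ifs <;> rfl

theorem current_eq (u : Fin (k + 1)) (r : ℕ) : current adv ω u r =
    ((adv.round ω r).input u).or (adv.stateAfter (adv.history ω r) (adv.proc u)).2 := by
  simp [current, Adversary.round, Adversary.nextRound, timeDivision]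

theorem stateAfter_succ_snd (u : Fin (k + 1)) (r : ℕ) :
    (adv.stateAfter (adv.history ω (r + 1)) (adv.proc u)).2 =
      if parity r = slot u then none else current adv ω u r := by
  rw [← stateAfter_fst adv ω r (adv.proc u)]
  simp only [current, Adversary.round, Adversary.history, Adversary.stateAfter,
    Adversary.nextRound, timeDivision, Equiv.symm_apply_apply]
  split_ifs <;> rfl

theorem ack_iff (u : Fin (k + 1)) (r : ℕ) (m : Msg) :
    adv.Ack ω u r m ↔ parity r = slot u ∧ current adv ω u r = some m := by
  rw [← stateAfter_fst adv ω r (adv.proc u)]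
  simp only [current, Adversary.Ack, Adversary.round,
    Adversary.nextRound, timeDivision, Equiv.symm_apply_apply]
  split_ifs with h
  · exact ⟨fun h' => ⟨h, h'⟩, fun h' => h'.2⟩
  · exact ⟨fun h' => absurd h' (by simp), fun h' => absurd h'.1 h⟩

/-- The packet that node `u` transmits in round `r`. -/
noncomputable def sentPacket (u : Fin (k + 1)) (r : ℕ) : Option Msg :=
  if parity r = slot u ∧ u.val ≤ 1 then current adv ω u r else none

theorem rcv_iff (u : Fin (k + 1)) (r : ℕ) (m : Msg) :
    adv.Rcv ω u r m ↔ parity r ≠ slot u ∧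
      heard (adv.round ω r).reach (fun v => sentPacket adv ω v r) u = some m := by
  have hs : (fun v => sentPacket adv ω v r) = fun v => (adv.round ω r).packet (adv.proc v) := by
    funext v
    rw [sentPacket, ← stateAfter_fst adv ω r (adv.proc v)]
    simp only [current, Adversary.round,
      Adversary.nextRound, timeDivision, Equiv.symm_apply_apply]
  rw [hs, ← stateAfter_fst adv ω r (adv.proc u)]
  simp only [Adversary.Rcv, Adversary.round,
    Adversary.nextRound, timeDivision, Equiv.symm_apply_apply]
  split_ifs with h
  · exact ⟨fun h' => absurd h' (by simp), fun h' => absurd h h'.1⟩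
  · simp only [Option.mem_toFinset, Option.mem_def]
    exact ⟨fun h' => ⟨h, h'⟩, fun h' => h'.2⟩

/-- A message is carried over only out of a round of the wrong parity, and two consecutive rounds
cannot both be of the wrong parity, so it is at most one round old. -/
theorem bcast_of_current {u : Fin (k + 1)} {r : ℕ} {m : Msg} (h : current adv ω u r = some m) :
    adv.Bcast ω u r m ∨ ∃ r₀, r = r₀ + 1 ∧ parity r₀ ≠ slot u ∧ adv.Bcast ω u r₀ m := by
  have key : ∀ r, current adv ω u r = some m → ¬ adv.Bcast ω u r m →
      ∃ r₀, r = r₀ + 1 ∧ parity r₀ ≠ slot u ∧ current adv ω u r₀ = some m := by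
    intro r h hb
    rw [current_eq, Option.or_eq_some_iff] at h
    have h := (h.resolve_left hb).2
    cases r with
    | zero => exact absurd h (by simp [Adversary.history, Adversary.stateAfter, timeDivision])
    | succ r =>
      rw [stateAfter_succ_snd] at h
      split_ifs at h with hp
      exact ⟨r, rfl, hp, h⟩
  by_cases hb : adv.Bcast ω u r m
  · exact Or.inl hb
  obtain ⟨r₀, rfl, hp, hc⟩ := key r h hb
  refine Or.inr ⟨r₀, rfl, hp, ?_⟩
  by_contra hb₀
  obtain ⟨r₁, rfl, hp₁, -⟩ := key r₀ hc hb₀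
  rw [parity_succ] at hp
  cases h1 : parity r₁ <;> cases h2 : slot u <;> simp_all

theorem bcast_of_ack {u : Fin (k + 1)} {r : ℕ} {m : Msg} (h : adv.Ack ω u r m) :
    (parity r = slot u ∧ adv.Bcast ω u r m) ∨
      ∃ r₀, r = r₀ + 1 ∧ parity r₀ ≠ slot u ∧ adv.Bcast ω u r₀ m := by
  rw [ack_iff] at h
  exact (bcast_of_current adv ω h.2).imp (fun hb => ⟨h.1, hb⟩) id

variable {adv}

/-- The danger is that a new input in round `r + 1` displaces the pending message. Well-formedness
would then require an acknowledgment in round `r`, which has the wrong parity. -/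
theorem ack_of_bcast (hwf : adv.WellFormed) {u : Fin (k + 1)} {r : ℕ} {m : Msg}
    (h : adv.Bcast ω u r m) :
    adv.Ack ω u (if parity r = slot u then r else r + 1) m := by
  have hc : current adv ω u r = some m := by
    rw [current_eq]
    rw [Adversary.Bcast] at h
    simp [h]
  split_ifs with hp
  · exact (ack_iff adv ω u r m).2 ⟨hp, hc⟩
  · rw [ack_iff, parity_succ]
    refine ⟨by cases h1 : parity r <;> cases h2 : slot u <;> simp_all, ?_⟩
    rw [current_eq, stateAfter_succ_snd, if_neg hp, hc]
    cases hi : (adv.round ω (r + 1)).input u with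
    | none => rfl
    | some m' =>
      obtain ⟨q, hq, hq', m'', hack⟩ := (hwf ω).2 u r (r + 1) m m' (Nat.lt_succ_self r) h hi
      have : q = r := by omega
      subst this
      exact absurd ((ack_iff adv ω u q m'').1 hack).1 hp

theorem ack_time (hwf : adv.WellFormed) {u : Fin (k + 1)} {r r' : ℕ} {m : Msg}
    (h : adv.Bcast ω u r m) (h' : adv.Ack ω u r' m) :
    r' = if parity r = slot u then r else r + 1 := by
  rcases bcast_of_ack adv ω h' with ⟨hp, hb⟩ | ⟨r₀, rfl, hp, hb⟩
  · obtain ⟨-, rfl⟩ := (hwf ω).1 u u _ _ m h hb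
    rw [if_pos hp]
  · obtain ⟨-, rfl⟩ := (hwf ω).1 u u _ _ m h hb
    rw [if_neg hp]

theorem activeWith_of_ack (hwf : adv.WellFormed) {u : Fin (k + 1)} {r : ℕ} {m : Msg}
    (h : adv.Ack ω u r m) : adv.ActiveWith ω u r m := by
  have : ∃ r₀ ≤ r, adv.Bcast ω u r₀ m := by
    rcases bcast_of_ack adv ω h with ⟨-, hb⟩ | ⟨r₀, rfl, -, hb⟩
    · exact ⟨r, le_rfl, hb⟩
    · exact ⟨r₀, Nat.le_succ r₀, hb⟩
  obtain ⟨r₀, hr₀, hb⟩ := this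
  refine ⟨r₀, hr₀, hb, fun r₁ _ h1 h2 => ?_⟩
  have e1 := ack_time ω hwf hb h
  have e2 := ack_time ω hwf hb h2
  omega

theorem ack_of_rcv {u : Fin (k + 1)} {r : ℕ} {m : Msg} (h : adv.Rcv ω u r m) :
    ∃ v, N.G'.Adj u v ∧ adv.Ack ω v r m := by
  rw [rcv_iff] at h
  obtain ⟨hp, hh⟩ := h
  rw [heard] at hh
  have hu : sentPacket adv ω u r = none := by rw [sentPacket, if_neg fun h => hp h.1]
  simp only [hu, Option.isSome_none, Bool.false_eq_true, if_false] at hh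
  split_ifs at hh with hex
  have hv := hex.choose_spec.1
  set v := hex.choose
  refine ⟨v, adv.reach_le _ _ _ _ hv.1, ?_⟩
  rw [ack_iff]
  rw [sentPacket] at hh
  split_ifs at hh with hc
  exact ⟨hc.1, hh⟩

/-- Only nodes `0` and `1` ever transmit, in rounds of opposite parity, so `v` is the sole
transmitter in the round of its acknowledgment, and no reach set can cause a collision. -/
theorem rcv_of_ack {u v : Fin (k + 1)} {r : ℕ} {m : Msg} (h : adv.Ack ω v r m)
    (huv : N.G.Adj u v) (hval : (u.val = 0 ∧ v.val = 1) ∨ (v.val = 0 ∧ u.val = 1)) :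
    adv.Rcv ω u r m := by
  rw [ack_iff] at h
  have hslot : slot u ≠ slot v := by
    rcases hval with ⟨h0, h1⟩ | ⟨h0, h1⟩ <;> simp [slot, h0, h1]
  have hpu : parity r ≠ slot u := by rw [h.1]; exact hslot.symm
  have hsv : sentPacket adv ω v r = some m := by
    rw [sentPacket, if_pos ⟨h.1, by omega⟩, h.2]
  have hsu : sentPacket adv ω u r = none := by rw [sentPacket, if_neg fun h => hpu h.1]
  rw [rcv_iff]
  refine ⟨hpu, ?_⟩
  have hreach : (adv.round ω r).reach.Adj u v := adv.le_reach _ _ _ _ huv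
  have hex : ∃! w, (adv.round ω r).reach.Adj u w ∧ (sentPacket adv ω w r).isSome := by
    refine ⟨v, ⟨hreach, by simp [hsv]⟩, ?_⟩
    rintro w ⟨-, hw⟩
    by_cases hc : parity r = slot w ∧ w.val ≤ 1
    · have hsl : slot w = slot v := hc.1.symm.trans h.1
      have hw1 := hc.2
      have hw0 : (w.val = 0) ↔ (v.val = 0) := by
        have := congrArg (fun b => b = false) hsl
        simpa [slot] using this
      exact Fin.ext (by omega)
    · rw [sentPacket, if_neg hc] at hw
      simp at hw
  rw [heard]
  simp only [hsu, Option.isSome_none, Bool.false_eq_true, if_false]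
  rw [dif_pos hex]
  have : hex.choose = v := hex.unique hex.choose_spec.1 ⟨hreach, by simp [hsv]⟩
  rw [this, hsv]

theorem solvesLocalBroadcast
    (hN : ∀ u v, N.G.Adj u v → (u.val = 0 ∧ v.val = 1) ∨ (v.val = 0 ∧ u.val = 1)) :
    (timeDivision k).SolvesLocalBroadcast N where
  ack_existsUnique adv hwf ω u r m h :=
    ⟨_, ⟨by split_ifs <;> omega, ack_of_bcast ω hwf h⟩, fun _ h' => ack_time ω hwf h h'.2⟩
  ack_response adv hwf ω u r m h := by
    obtain ⟨r₀, hr₀, hb, -⟩ := activeWith_of_ack ω hwf h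
    exact ⟨r₀, hr₀, hb⟩
  rcv_unique adv hwf ω v r t m h h' := by
    obtain ⟨u, -, hu⟩ := ack_of_rcv ω h
    obtain ⟨u', -, hu'⟩ := ack_of_rcv ω h'
    obtain ⟨r₀, -, hb, -⟩ := activeWith_of_ack ω hwf hu
    obtain ⟨t₀, -, hb', -⟩ := activeWith_of_ack ω hwf hu'
    obtain ⟨rfl, rfl⟩ := (hwf ω).1 _ _ _ _ m hb hb'
    rw [ack_time ω hwf hb hu, ack_time ω hwf hb hu']
  rcv_active adv hwf ω v r m h := by
    obtain ⟨u, hadj, hu⟩ := ack_of_rcv ω h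
    exact ⟨u, hadj, activeWith_of_ack ω hwf hu⟩
  delivery adv hwf u r m := WHP.of_forall fun ω _ r' hr' hack v hadj =>
    ⟨r', hr', le_rfl, rcv_of_ack ω hack hadj.symm (hN v u hadj.symm)⟩

theorem hasProgressBound
    (hN : ∀ u v, N.G.Adj u v → (u.val = 0 ∧ v.val = 1) ∨ (v.val = 0 ∧ u.val = 1)) :
    (timeDivision k).HasProgressBound N fun _ => 1 := by
  refine fun adv hwf r r' u _ => WHP.of_forall fun ω hlt ⟨v, hadj, hact⟩ => ?_
  have hlt' : r + 1 < r' := by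
    have : (r : ℝ) + 1 < r' := by linarith
    exact_mod_cast this
  obtain ⟨m, r₀, hr₀, hb, hno⟩ := hact r le_rfl (by omega)
  have hack := ack_of_bcast ω hwf hb
  set q := if parity r₀ = slot v then r₀ else r₀ + 1 with hq
  have hq' : q ≤ r₀ + 1 := by rw [hq]; split_ifs <;> omega
  exact ⟨q, by omega, m, rcv_of_ack ω hack hadj (hN u v hadj), r, le_rfl, by omega, v,
    r₀, hr₀, hb, hno⟩

end timeDivision

/-! ## The lower bound for distributed algorithms -/

theorem heard_eq_none {n : ℕ} {Packet : Type} {R : SimpleGraph (Fin n)}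
    {p : Fin n → Option Packet} {u : Fin n} (hu : p u = none)
    (h : ¬ ∃! v, R.Adj u v ∧ (p v).isSome) : heard R p u = none := by
  rw [heard, if_neg (by simp [hu]), dif_neg h]

theorem heard_eq {n : ℕ} {Packet : Type} {R : SimpleGraph (Fin n)}
    {p : Fin n → Option Packet} {u v : Fin n} (hu : p u = none)
    (hv : R.Adj u v ∧ (p v).isSome) (huniq : ∀ w, R.Adj u w ∧ (p w).isSome → w = v) :
    heard R p u = p v := by
  have hex : ∃! w, R.Adj u w ∧ (p w).isSome := ⟨v, hv, huniq⟩
  rw [heard, if_neg (by simp [hu]), dif_pos hex, huniq _ hex.choose_spec.1]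

/-! ### The reference run, which does not depend on the assignment of processes -/

section Reference

variable {n : ℕ} [NeZero n] (D : DistributedAlgorithm n) (msg : Fin n → Msg) (ω : Coins n)

/-- The input of process `i` in round `t` of the reference run. -/
def refInput (t : ℕ) (i : Fin n) : Option Msg :=
  if t = 0 ∧ i ≠ 0 then some (msg i) else none

/-- The states before round `t` in the run in which every process hears its own packet if it
transmits, and otherwise that of process `0`. -/
def refState : ℕ → ∀ i, (D.automaton i).State
  | 0, i => (D.automaton i).start
  | t + 1, i =>
    let sent := fun j => (D.automaton j).send (refState t j) (refInput msg t j) (ω (j, t, false))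
    ((D.automaton i).receive (sent i).1 ((sent i).2.or (sent 0).2) (ω (i, t, true))).1

/-- The middle state and the packet of process `i` in round `t` of the reference run. -/
def refSent (t : ℕ) (i : Fin n) : (D.automaton i).State × Option D.Packet :=
  (D.automaton i).send (refState D msg ω t i) (refInput msg t i) (ω (i, t, false))

/-- The end state and the output of process `i` in round `t` of the reference run. -/
def refReceived (t : ℕ) (i : Fin n) : (D.automaton i).State × Output :=
  (D.automaton i).receive (refSent D msg ω t i).1
    ((refSent D msg ω t i).2.or (refSent D msg ω t 0).2) (ω (i, t, true))

theorem refState_succ (t : ℕ) (i : Fin n) :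
    refState D msg ω (t + 1) i = (refReceived D msg ω t i).1 := rfl

/-- Process `0` gets no input and hears only itself, so its run is autonomous. -/
theorem refState_zero_eq (msg' : Fin n → Msg) (t : ℕ) :
    refState D msg ω t 0 = refState D msg' ω t 0 := by
  induction t with
  | zero => rfl
  | succ t ih => simp [refState_succ, refReceived, refSent, refInput, ih]

theorem refReceived_zero_eq (msg' : Fin n → Msg) (t : ℕ) :
    refReceived D msg ω t 0 = refReceived D msg' ω t 0 := by
  simp [refReceived, refSent, refInput, refState_zero_eq D msg ω msg' t]

end Reference

/-! ### The spoiling adversary and its coupling with the reference run -/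

section Adversary

variable {k d : ℕ} {hk : 1 ≤ k} {hd : 1 ≤ d}

/-- The adversary that gives every sender its message at the beginning, and adds all the
unreliable links in exactly those rounds in which node `0` or node `1` transmits. -/
def spoiler (hk : 1 ≤ k) (hd : 1 ≤ d) (D : DistributedAlgorithm (k + 1)) (msg : Fin (k + 1) → Msg)
    (proc : Fin (k + 1) ≃ Fin (k + 1)) :
    Adversary (starNetwork k d hk hd).toNetwork D.toCentralized where
  proc := proc
  bcast h u := if h.length = 0 ∧ u ≠ 0 then some (msg (proc u)) else none
  reach _ _ _ p := if (p (proc 0)).isSome ∨ (p (proc 1)).isSome then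
    (starNetwork k d hk hd).G' else (starNetwork k d hk hd).G
  le_reach _ _ _ _ := by
    split_ifs
    exacts [(starNetwork k d hk hd).le, le_rfl]
  reach_le _ _ _ _ := by
    split_ifs
    exacts [le_rfl, (starNetwork k d hk hd).le]

variable (D : DistributedAlgorithm (k + 1)) {msg : Fin (k + 1) → Msg}
  {proc : Fin (k + 1) ≃ Fin (k + 1)} (ω : Coins (k + 1))

theorem spoiler_bcast_iff (u : Fin (k + 1)) (r : ℕ) (m : Msg) :
    (spoiler hk hd D msg proc).Bcast ω u r m ↔ r = 0 ∧ u ≠ 0 ∧ m = msg (proc u) := by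
  have : (spoiler hk hd D msg proc).Bcast ω u r m ↔
      (if ((spoiler hk hd D msg proc).history ω r).length = 0 ∧ u ≠ 0
        then some (msg (proc u)) else none) = some m := Iff.rfl
  rw [this, Adversary.length_history]
  split_ifs with h
  · simp [h, eq_comm]
  · simp only [false_iff]
    exact fun h' => h ⟨h'.1, h'.2.1⟩

theorem spoiler_wellFormed (hmsg : Function.Injective msg) :
    (spoiler hk hd D msg proc).WellFormed := by
  refine fun ω => ⟨fun u v r t m h h' => ?_, fun u r t m m' hrt h h' => ?_⟩
  · rw [spoiler_bcast_iff] at h h'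
    exact ⟨proc.injective (hmsg (h.2.2.symm.trans h'.2.2)), h.1.trans h'.1.symm⟩
  · rw [spoiler_bcast_iff] at h h'
    omega

theorem spoiler_oneShot :
    (spoiler hk hd D msg proc).OneShot (starNetwork k d hk hd).senders := by
  intro ω u r m h
  rw [spoiler_bcast_iff] at h
  exact ⟨h.1, h.2.1⟩

variable (msg proc) in
/-- In the first `T` rounds of the reference run, whenever the process at node `1` transmits, so
does the process at some other neighbour of node `0`. -/
def Covered (d T : ℕ) : Prop :=
  ∀ t < T, (refSent D msg ω t (proc 1)).2.isSome →
    ∃ u : Fin (k + 1), 2 ≤ u.val ∧ u.val ≤ d ∧ (refSent D msg ω t (proc u)).2.isSome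

/-- If node `1` transmits, all links are on and a second transmitter collides with it at node `0`;
if `0` and `1` are both silent, node `0` has only its reliable, silent neighbour. Every other linked
node has `0` as its only possible neighbour and is joined to it whenever `0` transmits. The nodes
beyond `d` are excluded because they never hear `0`. -/
theorem heard_spoiler {Packet : Type} (p : Fin (k + 1) → Option Packet)
    (hp : (p 1).isSome → ∃ u : Fin (k + 1), 2 ≤ u.val ∧ u.val ≤ d ∧ (p u).isSome)
    (u : Fin (k + 1)) (hu : u.val ≤ d) :
    heard (if (p 0).isSome ∨ (p 1).isSome then (starNetwork k d hk hd).G'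
      else (starNetwork k d hk hd).G) p u = (p u).or (p 0) := by
  have h1 : (1 : Fin (k + 1)).val = 1 := by
    rw [Fin.val_one', Nat.mod_eq_of_lt]; omega
  have h0 : (0 : Fin (k + 1)).val = 0 := rfl
  obtain ⟨R, hR⟩ : ∃ R, R = if (p 0).isSome ∨ (p 1).isSome then (starNetwork k d hk hd).G'
      else (starNetwork k d hk hd).G := ⟨_, rfl⟩
  rw [← hR]
  have hRle : R ≤ (starNetwork k d hk hd).G' := by
    rw [hR]; split_ifs
    exacts [le_rfl, (starNetwork k d hk hd).le]
  by_cases hpu : (p u).isSome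
  · obtain ⟨x, hx⟩ := Option.isSome_iff_exists.1 hpu
    simp [heard, hx]
  have hpu' : p u = none := by simpa using hpu
  by_cases hu0 : u.val = 0
  · have hu0' : u = 0 := Fin.ext hu0
    subst hu0'
    rw [hpu', Option.none_or]
    refine heard_eq_none hpu' ?_
    rintro ⟨v, ⟨hv, hpv⟩, huniq⟩
    by_cases hp1 : (p 1).isSome
    · rw [if_pos (Or.inr hp1)] at hR
      subst hR
      obtain ⟨w, hw2, hwd, hpw⟩ := hp hp1
      have e1 := huniq 1 ⟨starNetwork_G'_adj.2 (Or.inl ⟨h0, by omega, by omega⟩), hp1⟩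
      have e2 := huniq w ⟨starNetwork_G'_adj.2 (Or.inl ⟨h0, by omega, by omega⟩), hpw⟩
      have := congrArg Fin.val (e1.trans e2.symm)
      omega
    · rw [if_neg (not_or.2 ⟨hpu, hp1⟩)] at hR
      subst hR
      rw [starNetwork_G_adj] at hv
      have : v = 1 := Fin.ext (by omega)
      exact hp1 (this ▸ hpv)
  · rw [hpu', Option.none_or]
    have huniq : ∀ v, R.Adj u v → v = 0 := by
      intro v hv
      have hv := hRle hv
      rw [starNetwork_G'_adj] at hv
      exact Fin.ext (by omega)
    by_cases hp0 : (p 0).isSome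
    · rw [if_pos (Or.inl hp0)] at hR
      refine heard_eq hpu' ⟨?_, hp0⟩ fun v hv => huniq v hv.1
      rw [hR, starNetwork_G'_adj]
      exact Or.inr ⟨h0, by omega, hu⟩
    · have hp0' : p 0 = none := by simpa using hp0
      rw [hp0']
      refine heard_eq_none hpu' ?_
      rintro ⟨v, ⟨hv, hpv⟩, -⟩
      exact hp0 (huniq v hv ▸ hpv)

/-- Induction on rounds: equal states give equal packets, and by `heard_spoiler` what is heard is
then what the reference run prescribes. -/
theorem spoiler_run (h0 : proc 0 = 0) {T : ℕ} (hcov : Covered D msg proc ω d T) (t : ℕ) :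
    (t ≤ T → ∀ u : Fin (k + 1), u.val ≤ d →
      (spoiler hk hd D msg proc).stateAfter ((spoiler hk hd D msg proc).history ω t) (proc u) =
        refState D msg ω t (proc u)) ∧
    (t < T → ∀ u : Fin (k + 1), u.val ≤ d →
      (((spoiler hk hd D msg proc).round ω t).endState (proc u),
        ((spoiler hk hd D msg proc).round ω t).output (proc u)) =
        refReceived D msg ω t (proc u)) := by
  have h1 : (1 : Fin (k + 1)).val = 1 := by
    rw [Fin.val_one', Nat.mod_eq_of_lt]; omega
  set adv := spoiler hk hd D msg proc with hadv
  have step : ∀ t, t < T → (∀ u : Fin (k + 1), u.val ≤ d →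
      adv.stateAfter (adv.history ω t) (proc u) = refState D msg ω t (proc u)) →
      ∀ u : Fin (k + 1), u.val ≤ d →
      ((adv.round ω t).endState (proc u), (adv.round ω t).output (proc u)) =
        refReceived D msg ω t (proc u) := by
    intro t ht hst
    have hsent : ∀ u : Fin (k + 1), u.val ≤ d → ((adv.round ω t).midState (proc u),
        (adv.round ω t).packet (proc u)) = refSent D msg ω t (proc u) := by
      intro u hu
      have e : ((adv.round ω t).midState (proc u), (adv.round ω t).packet (proc u)) =
          (D.automaton (proc u)).send (adv.stateAfter (adv.history ω t) (proc u))
            (adv.bcast (adv.history ω t) (proc.symm (proc u)))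
            (ω (proc u, (adv.history ω t).length, false)) := rfl
      have e2 : adv.bcast (adv.history ω t) u = refInput msg t (proc u) := by
        have : adv.bcast (adv.history ω t) u = if (adv.history ω t).length = 0 ∧ u ≠ 0
          then some (msg (proc u)) else none := rfl
        rw [this, Adversary.length_history, refInput]
        have : proc u ≠ 0 ↔ u ≠ 0 := by
          rw [not_iff_not]
          exact ⟨fun h => proc.injective (h.trans h0.symm), fun h => h ▸ h0⟩
        simp only [this]
      rw [e, hst u hu, Equiv.symm_apply_apply, e2, Adversary.length_history]
      rfl
    intro u hu
    obtain ⟨p, hpdef⟩ : ∃ p : Fin (k + 1) → Option D.Packet,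
      p = fun v => (adv.round ω t).packet (proc v) := ⟨_, rfl⟩
    have hp : ∀ u : Fin (k + 1), u.val ≤ d → p u = (refSent D msg ω t (proc u)).2 := by
      intro u hu
      rw [hpdef]
      exact congrArg Prod.snd (hsent u hu)
    have e : ((adv.round ω t).endState (proc u), (adv.round ω t).output (proc u)) =
        (D.automaton (proc u)).receive ((adv.round ω t).midState (proc u))
          (heard (if (p 0).isSome ∨ (p 1).isSome
            then (starNetwork k d hk hd).G' else (starNetwork k d hk hd).G)
            p (proc.symm (proc u)))
          (ω (proc u, (adv.history ω t).length, true)) := by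
      rw [hpdef]; rfl
    have hheard := heard_spoiler (hk := hk) (hd := hd) p (by
        intro hp1
        rw [hp 1 (by omega)] at hp1
        obtain ⟨w, hw2, hwd, hw⟩ := hcov t ht hp1
        exact ⟨w, hw2, hwd, by rw [hp w hwd]; exact hw⟩) u hu
    have hmid : (adv.round ω t).midState (proc u) = (refSent D msg ω t (proc u)).1 :=
      congrArg Prod.fst (hsent u hu)
    rw [e, Equiv.symm_apply_apply, hheard, hp u hu, hp 0 (by simp), Adversary.length_history, h0]
    exact congrArg (fun s => (D.automaton (proc u)).receive s _ _) hmid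
  have main : ∀ t, t ≤ T → ∀ u : Fin (k + 1), u.val ≤ d →
      adv.stateAfter (adv.history ω t) (proc u) = refState D msg ω t (proc u) := by
    intro t
    induction t with
    | zero => exact fun _ u _ => rfl
    | succ t ih =>
      intro ht u hu
      have ht' : t < T := ht
      exact congrArg Prod.fst (step t ht' (ih ht'.le) u hu)
  exact ⟨main t, fun ht => step t ht (main t ht.le)⟩

end Adversary

instance (n : ℕ) : IsProbabilityMeasure (coinMeasure n) := by
  unfold coinMeasure
  infer_instance

/-! ### Secrecy of the messages, and averaging over assignments -/

section LowerBound

variable {k d : ℕ} {hk : 1 ≤ k} {hd : 1 ≤ d} {D : DistributedAlgorithm (k + 1)}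

/-- A receiver that hears nothing delivers nothing: the messages are unknown to it. -/
theorem refReceived_rcv_eq_empty
    (hD : D.toCentralized.SolvesLocalBroadcast (starNetwork k d hk hd).toNetwork)
    (ω : Coins (k + 1)) {T : ℕ}
    (hex : ∀ msg : Fin (k + 1) → Msg, ∃ proc : Fin (k + 1) ≃ Fin (k + 1),
      proc 0 = 0 ∧ Covered D msg proc ω d T)
    (msg : Fin (k + 1) → Msg) {t : ℕ} (ht : t < T) :
    (refReceived D msg ω t 0).2.rcv = ∅ := by
  rw [Finset.eq_empty_iff_forall_notMem]
  intro m hm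
  have key : ∀ msg' : Fin (k + 1) → Msg, Function.Injective msg' → ∃ i, m = msg' i := by
    intro msg' hmsg'
    obtain ⟨proc, h0, hcov⟩ := hex msg'
    have hrun := (spoiler_run (hk := hk) (hd := hd) D ω h0 hcov t).2 ht 0 (by simp)
    have hrcv : (spoiler hk hd D msg' proc).Rcv ω 0 t m := by
      have e : ((spoiler hk hd D msg' proc).round ω t).output (proc 0) =
          (refReceived D msg ω t 0).2 := by
        rw [refReceived_zero_eq D msg ω msg' t]
        have := congrArg Prod.snd hrun
        rw [h0] at this ⊢
        exact this
      rw [← e] at hm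
      exact hm
    obtain ⟨w, -, r₀, -, hb, -⟩ := hD.rcv_active _ (spoiler_wellFormed D hmsg') ω 0 t m hrcv
    exact ⟨proc w, ((spoiler_bcast_iff D ω w r₀ m).1 hb).2.2⟩
  -- Process `0` behaves alike under every labelling, so a delivered `m` would lie in the ranges of
  -- two labellings chosen to be disjoint.
  obtain ⟨i, hi⟩ := key (fun i => i.val) Fin.val_injective
  obtain ⟨j, hj⟩ := key (fun i => i.val + (k + 1))
    (fun i j h => Fin.val_injective (Nat.add_right_cancel h))
  have := i.isLt
  have hij : i.val = j.val + (k + 1) := hi.symm.trans hj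
  omega

theorem spoiler_maxContention (hdk : d ≤ k) {msg : Fin (k + 1) → Msg}
    {proc : Fin (k + 1) ≃ Fin (k + 1)} (ω : Coins (k + 1)) (r' : ℕ) :
    (spoiler hk hd D msg proc).maxContention ω 0 0 r' = d := by
  have hle : ∀ t, (spoiler hk hd D msg proc).contention ω 0 t ≤ d := by
    intro t
    refine le_trans (Set.ncard_le_ncard ?_ (Set.toFinite _))
      (ncard_neighborSet_zero (hk := hk) (hD := hd) hdk).le
    exact fun v hv => hv.1
  refine le_antisymm (Finset.sup_le fun t _ => hle t) ?_
  have h0 : (spoiler hk hd D msg proc).contention ω 0 0 = d := by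
    refine Eq.trans ?_ (ncard_neighborSet_zero (hk := hk) (hD := hd) hdk)
    rw [Adversary.contention]
    congr 1
    ext v
    refine ⟨fun hv => hv.1, fun hv => ⟨hv, ?_⟩⟩
    have hv0 : v ≠ 0 := ((SimpleGraph.mem_neighborSet _ _ _).1 hv).ne'
    refine ⟨msg (proc v), 0, le_rfl, ?_, fun _ _ h => by omega⟩
    exact (spoiler_bcast_iff D ω v 0 _).2 ⟨rfl, hv0, rfl⟩
  have := Finset.le_sup (f := fun t => (spoiler hk hd D msg proc).contention ω 0 t)
    (Finset.left_mem_Icc.2 (Nat.zero_le r'))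
  rw [h0] at this
  exact this

/-- By delivery and progress, node `0` receives something in time with high probability. -/
theorem coinMeasure_no_rcv_le (hdk : d ≤ k)
    (hD : D.toCentralized.SolvesLocalBroadcast (starNetwork k d hk hd).toNetwork) {f : ℕ → ℝ}
    (hf : D.toCentralized.HasOneShotProgressBound (starNetwork k d hk hd).toNetwork
      (starNetwork k d hk hd).senders f)
    {r' : ℕ} (hr' : f d < r') {msg : Fin (k + 1) → Msg} (hmsg : Function.Injective msg)
    (proc : Fin (k + 1) ≃ Fin (k + 1)) :
    coinMeasure (k + 1) {ω | ∀ t ≤ r', ∀ m, ¬ (spoiler hk hd D msg proc).Rcv ω 0 t m} ≤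
      2 * ((k + 1 : ℕ) : ℝ≥0∞)⁻¹ := by
  have hwf : (spoiler hk hd D msg proc).WellFormed := spoiler_wellFormed D hmsg
  have h1 : (1 : Fin (k + 1)).val = 1 := by
    rw [Fin.val_one', Nat.mod_eq_of_lt]; omega
  have h10 : (1 : Fin (k + 1)) ≠ 0 := by
    intro h
    have := congrArg Fin.val h
    simp only [Fin.val_zero] at this
    omega
  have hdel := hD.delivery _ hwf 1 0 (msg (proc 1))
  have hprog := hf _ hwf (spoiler_oneShot D) 0 r' 0 (Nat.zero_le _)
  rw [WHP] at hdel hprog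
  rw [two_mul]
  refine le_trans (measure_mono ?_) ((measure_union_le _ _).trans (add_le_add hdel hprog))
  intro ω hω
  have hb : (spoiler hk hd D msg proc).Bcast ω 1 0 (msg (proc 1)) :=
    (spoiler_bcast_iff D ω 1 0 _).2 ⟨rfl, h10, rfl⟩
  -- If node `1` acknowledges before `r'`, then delivery fails; otherwise it stays active through
  -- `r'`, and progress fails.
  by_cases hack : ∃ r₁ < r', (spoiler hk hd D msg proc).Ack ω 1 r₁ (msg (proc 1))
  · left
    obtain ⟨r₁, hr₁, hack⟩ := hack
    intro hall
    obtain ⟨t, -, ht, hrcv⟩ := hall hb r₁ (Nat.zero_le _) hack 0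
      (starNetwork_G_adj.2 (Or.inr ⟨rfl, h1⟩))
    exact hω t (ht.trans hr₁.le) _ hrcv
  · right
    push Not at hack
    intro hall
    obtain ⟨t, ht, m, hrcv, -⟩ := hall (by rw [spoiler_maxContention hdk]; simpa using hr')
      ⟨1, starNetwork_G_adj.2 (Or.inl ⟨rfl, h1⟩), fun t _ ht =>
        ⟨msg (proc 1), 0, Nat.zero_le _, hb, fun r₁ _ hr₁ => hack r₁ (hr₁.trans_le ht)⟩⟩
    exact hω t ht m hrcv

/-- Place `0`, `v` and the elements of `W` at the nodes `0`, `1` and `2, …, |W| + 1 ≤ d`, and extend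
this partial injection to a bijection. -/
theorem exists_proc (hdk : d ≤ k) {v : Fin k} {W : Finset (Fin k)} (hv : v ∉ W)
    (hW : W.card < d) : ∃ proc : Fin (k + 1) ≃ Fin (k + 1), proc 0 = 0 ∧ proc 1 = v.succ ∧
      ∀ x ∈ W, ∃ u : Fin (k + 1), 2 ≤ u.val ∧ u.val ≤ d ∧ proc u = x.succ := by
  classical
  have h1 : (1 : Fin (k + 1)).val = 1 := by
    rw [Fin.val_one', Nat.mod_eq_of_lt]; omega
  let f : Fin (k + 1) → Fin (k + 1) := fun u =>
    if u.val = 0 then 0 else if u.val = 1 then v.succ else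
      -- The default `0` is harmless: `f` matters only on the first `|W| + 2` nodes.
      if h : u.val - 2 < W.card then (W.equivFin.symm ⟨u.val - 2, h⟩).val.succ else 0
  have f0 : ∀ u : Fin (k + 1), u.val = 0 → f u = 0 := fun u h => if_pos h
  have f1 : ∀ u : Fin (k + 1), u.val = 1 → f u = v.succ := fun u h => by
    simp only [f, h, one_ne_zero, if_false, if_true]
  have f2 : ∀ u : Fin (k + 1), ∀ i : Fin W.card, u.val = i.val + 2 →
      f u = (W.equivFin.symm i).val.succ := fun u i h => by
    simp only [f]
    rw [if_neg (by omega), if_neg (by omega), dif_pos (by omega)]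
    have e : u.val - 2 = i.val := by omega
    simp only [e, Fin.eta]
  have cases : ∀ u : Fin (k + 1), u.val < W.card + 2 →
      u.val = 0 ∨ u.val = 1 ∨ ∃ i : Fin W.card, u.val = i.val + 2 := by
    intro u hu
    by_cases h2 : 2 ≤ u.val
    · exact Or.inr (Or.inr ⟨⟨u.val - 2, by omega⟩, (Nat.sub_add_cancel h2).symm⟩)
    · omega
  have hne : ∀ i, (W.equivFin.symm i).val ≠ v := fun i h => hv (h ▸ (W.equivFin.symm i).2)
  have hinj : Set.InjOn f ↑(Finset.univ.filter fun u : Fin (k + 1) => u.val < W.card + 2) := by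
    intro a ha b hb hab
    simp only [Finset.coe_filter, Finset.mem_univ, true_and, Set.mem_ofPred_eq] at ha hb
    rcases cases a ha with ha | ha | ⟨i, ha⟩ <;> rcases cases b hb with hb | hb | ⟨j, hb⟩ <;>
      apply Fin.ext
    · omega
    · rw [f0 a ha, f1 b hb] at hab
      exact absurd hab.symm (Fin.succ_ne_zero _)
    · rw [f0 a ha, f2 b j hb] at hab
      exact absurd hab.symm (Fin.succ_ne_zero _)
    · rw [f1 a ha, f0 b hb] at hab
      exact absurd hab (Fin.succ_ne_zero _)
    · omega
    · rw [f1 a ha, f2 b j hb, Fin.succ_inj] at hab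
      exact absurd hab.symm (hne j)
    · rw [f2 a i ha, f0 b hb] at hab
      exact absurd hab (Fin.succ_ne_zero _)
    · rw [f2 a i ha, f1 b hb, Fin.succ_inj] at hab
      exact absurd hab (hne i)
    · rw [f2 a i ha, f2 b j hb, Fin.succ_inj] at hab
      have := W.equivFin.symm.injective (Subtype.ext hab)
      rw [ha, hb, this]
  obtain ⟨g, hg⟩ := Finset.exists_equiv_extend_of_card_eq (t := Finset.univ)
    (by simp) (Finset.subset_univ _) hinj
  refine ⟨g.trans (Equiv.subtypeUnivEquiv fun x => Finset.mem_univ x), ?_, ?_, ?_⟩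
  · exact (hg 0 (by simp)).trans (f0 0 rfl)
  · exact (hg 1 (Finset.mem_filter.2 ⟨Finset.mem_univ _, by omega⟩)).trans (f1 1 h1)
  · intro x hx
    have hi := (W.equivFin ⟨x, hx⟩).isLt
    refine ⟨⟨W.equivFin ⟨x, hx⟩ + 2, by omega⟩, by simp, by simp only; omega, ?_⟩
    refine (hg _ (by simp)).trans ((f2 _ (W.equivFin ⟨x, hx⟩) rfl).trans ?_)
    simp

open Classical in
-- The adversary must fix `proc` before the coins, while the good pairs `(v, W)` depend on the
-- coins. For every outcome the good pairs have probability at least the left side; for every pair,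
-- being good forces node `0` to deliver nothing, which has probability at most `2 / n`. Exchanging
-- the two averages gives the claim.
theorem failure_probability_le (hdk : d ≤ k)
    (hD : D.toCentralized.SolvesLocalBroadcast (starNetwork k d hk hd).toNetwork) {f : ℕ → ℝ}
    (hf : D.toCentralized.HasOneShotProgressBound (starNetwork k d hk hd).toNetwork
      (starNetwork k d hk hd).senders f)
    {r' : ℕ} (hr' : f d < r') {q : ℝ} (h0 : 0 < q) (h1 : q ≤ 1)
    (hpos : 0 < Real.exp (-((r' + 1 : ℕ) / (q * k))) - q - Real.exp (q * k) / 2 ^ d) :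
    Real.exp (-((r' + 1 : ℕ) / (q * k))) - q - Real.exp (q * k) / 2 ^ d ≤ 2 / (k + 1) := by
  set β : ℝ := Real.exp (-((r' + 1 : ℕ) / (q * k))) - q - Real.exp (q * k) / 2 ^ d with hβ
  have hk0 : (0 : ℝ) < k := by exact_mod_cast hk
  have : Nonempty (Fin k) := ⟨⟨0, hk⟩⟩
  let A : (Fin (k + 1) → Msg) → Coins (k + 1) → ℕ → Finset (Fin k) := fun msg ω t =>
    Finset.univ.filter fun x => (refSent D msg ω t x.succ).2.isSome
  let good : (Fin (k + 1) → Msg) → Coins (k + 1) → Fin k → Finset (Fin k) → Prop :=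
    fun msg ω v W => v ∉ W ∧ W.card < d ∧
      ∀ t < r' + 1, v ∈ A msg ω t → ∃ x ∈ W, x ∈ A msg ω t
  have hsum : ∀ msg ω, k * β ≤ ∑ v : Fin k, ∑ W : Finset (Fin k), bernoulliWeight q W *
      (if good msg ω v W then 1 else 0) := by
    intro msg ω
    have := card_mul_le_sum_cover h0 h1 d (r' + 1) (A msg ω)
    rw [Fintype.card_fin] at this
    refine this.trans (le_of_eq (Finset.sum_congr rfl fun v _ => Finset.sum_congr rfl fun W _ => ?_))
    by_cases hg : good msg ω v W
    · exact congrArg _ ((if_pos hg).trans (if_pos hg).symm)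
    · exact congrArg _ ((if_neg hg).trans (if_neg hg).symm)
  have hproc : ∀ v W, v ∉ W → W.card < d → ∃ proc : Fin (k + 1) ≃ Fin (k + 1), proc 0 = 0 ∧
      ∀ msg ω, good msg ω v W → Covered D msg proc ω d (r' + 1) := by
    intro v W hv hW
    obtain ⟨proc, hp0, hp1, hpW⟩ := exists_proc hdk hv hW
    refine ⟨proc, hp0, fun msg ω hg t ht hs => ?_⟩
    rw [hp1] at hs
    obtain ⟨x, hx, hxA⟩ := hg.2.2 t ht (Finset.mem_filter.2 ⟨Finset.mem_univ _, hs⟩)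
    obtain ⟨u, hu2, hud, hu⟩ := hpW x hx
    exact ⟨u, hu2, hud, by rw [hu]; exact (Finset.mem_filter.1 hxA).2⟩
  -- This is where `hpos` enters: secrecy needs, for the same coins, a covered assignment for every
  -- labelling, and a positive sum provides one.
  have hex : ∀ ω msg, ∃ proc : Fin (k + 1) ≃ Fin (k + 1),
      proc 0 = 0 ∧ Covered D msg proc ω d (r' + 1) := by
    intro ω msg
    have hlt := (mul_pos hk0 hpos).trans_le (hsum msg ω)
    by_contra hno
    refine absurd (Finset.sum_eq_zero fun v _ => Finset.sum_eq_zero fun W _ => ?_) hlt.ne'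
    rw [if_neg, mul_zero]
    intro hg
    obtain ⟨proc, hp0, hp⟩ := hproc v W hg.1 hg.2.1
    exact hno ⟨proc, hp0, hp msg ω hg⟩
  have hmsg : Function.Injective (fun i : Fin (k + 1) => i.val) := Fin.val_injective
  have hmain := le_of_forall_le_sum_indicator (coinMeasure (k + 1))
    (Finset.univ : Finset (Fin k × Finset (Fin k)))
    (fun i => ENNReal.ofReal (bernoulliWeight q i.2))
    (fun i => {ω | good (fun i => i.val) ω i.1 i.2}) (ENNReal.ofReal (k * β))
    (2 * ((k + 1 : ℕ) : ℝ≥0∞)⁻¹) ?_ ?_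
  · have hw : ∑ i : Fin k × Finset (Fin k), ENNReal.ofReal (bernoulliWeight q i.2) =
        ENNReal.ofReal k := by
      rw [← ENNReal.ofReal_sum_of_nonneg fun i _ => bernoulliWeight_nonneg h0.le h1 i.2,
        Fintype.sum_prod_type]
      simp [sum_bernoulliWeight]
    have hδ : (2 * ((k + 1 : ℕ) : ℝ≥0∞)⁻¹) = ENNReal.ofReal (2 / (k + 1)) := by
      rw [ENNReal.ofReal_div_of_pos (by positivity), div_eq_mul_inv]
      congr 2
      · simp
      · rw [← Nat.cast_succ, ENNReal.ofReal_natCast]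
    rw [hw, hδ, ← ENNReal.ofReal_mul hk0.le, ENNReal.ofReal_le_ofReal_iff (by positivity)] at hmain
    exact le_of_mul_le_mul_left hmain hk0
  · rintro ⟨v, W⟩ -
    by_cases hvW : v ∉ W ∧ W.card < d
    · obtain ⟨proc, hp0, hp⟩ := hproc v W hvW.1 hvW.2
      refine le_trans (measure_mono ?_) (coinMeasure_no_rcv_le hdk hD hf hr' hmsg proc)
      intro ω hω t ht m hrcv
      have hrun := (spoiler_run (hk := hk) (hd := hd) D ω hp0 (hp _ ω hω) t).2 (by omega) 0
        (by simp)
      have hemp := refReceived_rcv_eq_empty hD ω (hex ω) (fun i => i.val) (t := t) (by omega)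
      have e := congrArg Prod.snd hrun
      rw [hp0] at e
      have hrcv' : m ∈ (((spoiler hk hd D (fun i => i.val) proc).round ω t).output
        (proc 0)).rcv := hrcv
      rw [hp0] at hrcv'
      have e' : (((spoiler hk hd D (fun i => i.val) proc).round ω t).output 0) =
        (refReceived D (fun i => i.val) ω t 0).2 := e
      rw [e', hemp] at hrcv'
      simp at hrcv'
    · have : {ω | good (fun i => i.val) ω v W} = ∅ := by
        ext ω
        simp only [Set.mem_ofPred_eq, Set.mem_empty_iff_false, iff_false]
        exact fun hg => hvW ⟨hg.1, hg.2.1⟩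
      simp only [this, measure_empty]
      exact zero_le
  · intro ω
    refine (ENNReal.ofReal_le_ofReal (hsum (fun i => i.val) ω)).trans (le_of_eq ?_)
    rw [← Fintype.sum_prod_type', ENNReal.ofReal_sum_of_nonneg]
    · refine Finset.sum_congr rfl fun i _ => ?_
      rw [ENNReal.ofReal_mul (bernoulliWeight_nonneg h0.le h1 _)]
      congr 1
      by_cases hg : good (fun i => i.val) ω i.1 i.2 <;> simp [hg]
    · intro i _
      exact mul_nonneg (bernoulliWeight_nonneg h0.le h1 _) (by split_ifs <;> norm_num)

end LowerBound

/-- With `x = k ^ (1/10)` the exponential is at least `1 / (2 x ^ 5)`, while the two subtracted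
terms and `2 / (k + 1)` are each at most `1 / x ^ 9`; and `x ≥ d ≥ 13`. -/
theorem two_div_lt_of_log_le {k d r' : ℕ} (hk : 2 ≤ k) (hkd : 20 * Real.log k ≤ d)
    (hdk : (d : ℝ) ≤ (k : ℝ) ^ (1 / 10 : ℝ))
    (hr' : (r' : ℝ) < 1 / 16 * (d * Real.log (k + 1 : ℕ)) + 1) :
    2 / ((k : ℝ) + 1) < Real.exp (-((r' + 1 : ℕ) / (d / (4 * k) * k))) - d / (4 * k) -
      Real.exp (d / (4 * k) * k) / 2 ^ d := by
  have hk2 : (2 : ℝ) ≤ k := by exact_mod_cast hk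
  have hk0 : (0 : ℝ) < k := by linarith
  have hlog2 := Real.log_two_gt_d9
  have hlogk : Real.log 2 ≤ Real.log k := Real.log_le_log (by norm_num) hk2
  have hd13 : (13 : ℝ) ≤ d := by linarith
  have hqk : (d : ℝ) / (4 * k) * k = d / 4 := by field_simp
  rw [hqk]
  set x : ℝ := (k : ℝ) ^ (1 / 10 : ℝ) with hx
  have hx13 : 13 ≤ x := hd13.trans hdk
  have hx0 : 0 < x := by linarith
  have hkx : (k : ℝ) = x ^ 10 := by
    rw [hx, ← Real.rpow_natCast, ← Real.rpow_mul hk0.le]; norm_num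
  have hlogx : Real.log k = 10 * Real.log x := by rw [hkx, Real.log_pow]; norm_num
  have e1 : 1 / (2 * x ^ 5) ≤ Real.exp (-((r' + 1 : ℕ) / (d / 4 : ℝ))) := by
    have hlogn : Real.log (k + 1 : ℕ) ≤ 20 * Real.log x := by
      have : ((k + 1 : ℕ) : ℝ) ≤ (k : ℝ) ^ 2 := by push_cast; nlinarith
      refine (Real.log_le_log (by positivity) this).trans ?_
      rw [Real.log_pow, hlogx]; push_cast; linarith
    -- Rounding up and counting round `0` add at most `2` to the number of rounds, hence at most `8
    -- / d ≤ 8 / 13 < log 2` here.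
    have h1 : ((r' + 1 : ℕ) / (d / 4 : ℝ)) ≤ 5 * Real.log x + Real.log 2 := by
      rw [div_le_iff₀ (by linarith)]
      push_cast
      have := mul_le_mul_of_nonneg_left hlogn (by linarith : (0 : ℝ) ≤ d)
      nlinarith
    calc 1 / (2 * x ^ 5) = Real.exp (-(5 * Real.log x + Real.log 2)) := by
          rw [Real.exp_neg, Real.exp_add, Real.exp_log (by norm_num),
            show (5 : ℝ) * Real.log x = (5 : ℕ) * Real.log x by norm_num, Real.exp_nat_mul,
            Real.exp_log hx0]
          rw [one_div, mul_comm]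
      _ ≤ _ := Real.exp_le_exp.2 (by linarith)
  have e2 : (d : ℝ) / (4 * k) ≤ 1 / x ^ 9 := by
    rw [div_le_div_iff₀ (by positivity) (by positivity), hkx]
    have : (d : ℝ) * x ^ 9 ≤ x * x ^ 9 := mul_le_mul_of_nonneg_right hdk (by positivity)
    have h10 : 0 < x ^ 10 := by positivity
    nlinarith
  have e3 : Real.exp (d / 4 : ℝ) / 2 ^ d ≤ 1 / x ^ 9 := by
    have h2 : (2 : ℝ) ^ d = Real.exp (d * Real.log 2) := by
      rw [Real.exp_nat_mul, Real.exp_log (by norm_num)]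
    have h9 : 1 / x ^ 9 = Real.exp (-(9 * Real.log x)) := by
      rw [Real.exp_neg, show (9 : ℝ) * Real.log x = (9 : ℕ) * Real.log x by norm_num,
        Real.exp_nat_mul, Real.exp_log hx0, one_div]
    rw [h2, h9, ← Real.exp_sub]
    refine Real.exp_le_exp.2 ?_
    nlinarith
  have e4 : 2 / ((k : ℝ) + 1) ≤ 1 / x ^ 9 := by
    rw [div_le_div_iff₀ (by positivity) (by positivity), hkx]
    have : 0 < x ^ 9 := by positivity
    nlinarith [mul_le_mul_of_nonneg_right hx13 this.le]
  have e5 : 3 * (1 / x ^ 9) < 1 / (2 * x ^ 5) := by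
    rw [mul_one_div, div_lt_div_iff₀ (by positivity) (by positivity)]
    have h4 : (13 : ℝ) ^ 4 ≤ x ^ 4 := pow_le_pow_left₀ (by norm_num) hx13 4
    have h5 : 0 < x ^ 5 := by positivity
    nlinarith [mul_le_mul_of_nonneg_right h4 h5.le]
  linarith

end DualRadio

open DualRadio in
theorem mainTheorem6 :
    ∃ C c : ℝ, 0 < c ∧ ∀ k Δ' : ℕ, 2 ≤ k → 20 * Real.log k ≤ Δ' → (Δ' : ℝ) ≤ (k : ℝ) ^ (1 / 10 : ℝ) →
      ∃ n : ℕ, k < n ∧ n ≤ k ^ 4 ∧ ∃ N : BipartiteNetwork n, N.maxReceiverDegree = Δ' ∧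
        (∃ A : CentralizedAlgorithm n, A.SolvesLocalBroadcast N.toNetwork ∧
          A.HasProgressBound N.toNetwork fun _ => C) ∧
        (∀ D : DistributedAlgorithm n, D.toCentralized.SolvesLocalBroadcast N.toNetwork →
          ∀ f : ℕ → ℝ, D.toCentralized.HasOneShotProgressBound N.toNetwork N.senders f →
            c * (Δ' * Real.log n) ≤ f Δ') := by
  refine ⟨1, 1 / 16, by norm_num, fun k d hk hkd hdk => ?_⟩
  have hk2 : (2 : ℝ) ≤ k := by exact_mod_cast hk
  have hd : 1 ≤ d := by
    have := Real.log_pos (by linarith : (1 : ℝ) < k)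
    have : (0 : ℝ) < d := by linarith
    exact_mod_cast this
  have hdk' : d ≤ k := by
    have : (k : ℝ) ^ (1 / 10 : ℝ) ≤ (k : ℝ) ^ (1 : ℝ) :=
      Real.rpow_le_rpow_of_exponent_le (by linarith) (by norm_num)
    rw [Real.rpow_one] at this
    exact_mod_cast hdk.trans this
  have hk1 : 1 ≤ k := by omega
  have hG : ∀ u v, (starNetwork k d hk1 hd).G.Adj u v →
      (u.val = 0 ∧ v.val = 1) ∨ (v.val = 0 ∧ u.val = 1) := fun u v => starNetwork_G_adj.1
  refine ⟨k + 1, k.lt_succ_self, ?_, starNetwork k d hk1 hd, maxReceiverDegree_starNetwork hdk',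
    ⟨timeDivision k, timeDivision.solvesLocalBroadcast hG, timeDivision.hasProgressBound hG⟩,
    fun D hD f hf => ?_⟩
  · calc k + 1 ≤ k ^ 2 := by nlinarith
      _ ≤ k ^ 4 := Nat.pow_le_pow_right hk1 (by norm_num)
  by_contra! hlt
  set y : ℝ := 1 / 16 * (d * Real.log (k + 1 : ℕ)) with hy
  have hy0 : 0 ≤ y := by
    have := Real.log_natCast_nonneg (k + 1)
    positivity
  -- The last round is `r' = ⌈y⌉`, which exceeds `f d` because `f d < y`.
  have hlt2 := two_div_lt_of_log_le hk hkd hdk (Nat.ceil_lt_add_one hy0)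
  have hq1 : (d : ℝ) / (4 * k) ≤ 1 := by
    rw [div_le_one (by linarith)]
    have : (d : ℝ) ≤ k := by exact_mod_cast hdk'
    linarith
  have hd0 : (0 : ℝ) < d := by exact_mod_cast hd
  have hfail := failure_probability_le hdk' hD hf (hlt.trans_le (Nat.le_ceil y))
    (by positivity) hq1 (lt_trans (by positivity) hlt2)
  linarith
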